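/- Let $\Bbbk$ be a field and let $\nu\in\Bbbk$ be nonzero. The Woronowicz algebra $\mathcal W_\nu(\mathfrak{sl}(2,\Bbbk))$ is the $\Bbbk$-algebra generated by $x,y,z$ with defining relations $$xz-\nu^4zx=(1+\nu^2)x,\qquad xy-\nu^2yx=\nu z,\qquad zy-\nu^4yz=(1+\nu^2)y .$$ (1) $\mathcal W_\nu(\mathfrak{sl}(2,\Bbbk))$ is a 3-dimensional skew polynomial algebra in $x,y,z$. That is, it is generated by $x,y,z$ with defining relations of the form $yz-\alpha zy=\lambda$, $zx-\beta xz=\mu$, $xy-\gamma yx=\rho$, where $\alpha,\beta,\gamma\in\Bbbk\setminus\{0\}$ and $\lambda,\mu,\rho\in\Bbbk+\Bbbk x+\Bbbk y+\Bbbk z$, and the monomials $x^iy^jz^l$ $(i,j,l\ge 0)$ form a $\Bbbk$-basis. (2) Put $x_1=x$, $x_2=y$, $x_3=z$ and order words by degree and then lexicographically, with $x_1\prec x_2\prec x_3$. Let $Q=\{(x_jx_i,f_{ji})\mid 1\le i<j\le 3\}$ with $$f_{21}=\nu^{-2}x_1x_2-\nu^{-1}x_3,\quad f_{31}=\nu^{-4}x_1x_3-\nu^{-4}(1+\nu^2)x_1,\quad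 f_{32}=\nu^4x_2x_3+(1+\nu^2)x_2 .$$ Then $Q$ is a skew reduction system (each $f_{ji}$ is $c\,x_ix_j+p$ with $c\in\Bbbk\setminus\{0\}$ and all words of $p$ at most $x_ix_j$), and the two-sided ideal of $\Bbbk\langle x_1,x_2,x_3\rangle$ generated by the elements $x_jx_i-f_{ji}$ is the ideal generated by the defining relations of $\mathcal W_\nu(\mathfrak{sl}(2,\Bbbk))$. The only ambiguity of $Q$ is the overlap ambiguity of $x_3x_2$ and $x_2x_1$ in the word $x_3x_2x_1$ (in particular there are no inclusion ambiguities). It is solvable: $f_{32}x_1$ and $x_3f_{21}$ can be brought to a common element by finite sequences of reductions, a reduction being a linear map that replaces one word $Ax_jx_iB$ by $Af_{ji}B$ and fixes all other words. Moreover $$\mathrm{stred}_Q(x_3f_{21})=\mathrm{stred}_Q(f_{32}x_1)=\nu^{-2}x_1x_2x_3-\nu^{-1}x_3^2 ,$$ where $\mathrm{stred}_Q(f)$ is the output of the following algorithm, which terminates on these two inputs. Start with $g=0$. While $f\ne0$, let $cw$ be the leading monomial of $f$ ($c\in\Bbbk$, $w$ a word). If $w$ is standard, i.e. its indices do not decrease,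 move $cw$ from $f$ to $g$. Otherwise write $w=Cx_jx_iB$ with $x_jx_i$ the leftmost pair with $j>i$, and replace $cw$ in $f$ by $c\,Cf_{ji}B$. The output is $g$. -/

import Mathlib

namespace SkewPoly

noncomputable section

/-! ### Free associative algebras and reduction systems -/

/-- The free associative algebra `k⟨X⟩`: formal `k`-linear combinations of words in `X`. -/
abbrev FreeAss (k X : Type*) [Field k] : Type _ := MonoidAlgebra k (FreeMonoid X)

/-- A word, seen as an element of `k⟨X⟩`. -/
def term (k : Type*) {X : Type*} [Field k] (w : FreeMonoid X) : FreeAss k X :=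
  MonoidAlgebra.single w 1

/-- A variable, seen as an element of `k⟨X⟩`. -/
def var (k : Type*) {X : Type*} [Field k] (a : X) : FreeAss k X :=
  term k (FreeMonoid.of a)

/-- A reduction system: a set of pairs `σ = (W_σ, f_σ)` of a word and a polynomial. -/
abbrev ReductionSystem (k X : Type*) [Field k] : Type _ :=
  Set (FreeMonoid X × FreeAss k X)

/-- The two-sided ideal `I_Q` generated by the polynomials `W_σ - f_σ`, `σ ∈ Q`. -/
def ReductionSystem.ideal {k X : Type*} [Field k] (Q : ReductionSystem k X) :
    TwoSidedIdeal (FreeAss k X) :=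
  TwoSidedIdeal.span {p | ∃ σ ∈ Q, p = term k σ.1 - σ.2}

open Classical in
/-- The reduction `r_{AσB}`: the linear endomorphism of `k⟨X⟩` that sends the word `A W_σ B` to
`A f_σ B` and fixes every other word. -/
def reduction {k X : Type*} [Field k] (A : FreeMonoid X) (σ : FreeMonoid X × FreeAss k X)
    (B : FreeMonoid X) (p : FreeAss k X) : FreeAss k X :=
  Finsupp.linearCombination k
    (fun V : FreeMonoid X =>
      if V = A * σ.1 * B then term k A * σ.2 * term k B else term k V) p.coeff

/-- `p →_Q q`: some finite composition of reductions sends `p` to `q`. -/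
def ReductionSystem.Reduces {k X : Type*} [Field k] (Q : ReductionSystem k X) :
    FreeAss k X → FreeAss k X → Prop :=
  Relation.ReflTransGen fun p q => ∃ σ ∈ Q, ∃ A B : FreeMonoid X, q = reduction A σ B p

/-- Overlap ambiguities `(σ, τ, A, B, C)`. -/
def ReductionSystem.IsOverlapAmbiguity {k X : Type*} [Field k] (Q : ReductionSystem k X)
    (σ τ : FreeMonoid X × FreeAss k X) (A B C : FreeMonoid X) : Prop :=
  σ ∈ Q ∧ τ ∈ Q ∧ A ≠ 1 ∧ B ≠ 1 ∧ C ≠ 1 ∧ σ.1 = A * B ∧ τ.1 = B * C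

/-- Inclusion ambiguities `(σ, τ, A, B, C)`. -/
def ReductionSystem.IsInclusionAmbiguity {k X : Type*} [Field k] (Q : ReductionSystem k X)
    (σ τ : FreeMonoid X × FreeAss k X) (A B C : FreeMonoid X) : Prop :=
  σ ∈ Q ∧ τ ∈ Q ∧ σ ≠ τ ∧ τ.1 = B ∧ σ.1 = A * B * C

/-- An overlap ambiguity is solvable if compositions of reductions send `f_σ C` and `A f_τ` to
the same element. -/
def ReductionSystem.OverlapSolvable {k X : Type*} [Field k] (Q : ReductionSystem k X)
    (σ τ : FreeMonoid X × FreeAss k X) (A C : FreeMonoid X) : Prop :=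
  ∃ g, Q.Reduces (σ.2 * term k C) g ∧ Q.Reduces (term k A * τ.2) g

/-! ### Skew reduction systems and reduction to standard form -/

/-- The (strict) degree-lexicographic order on words, with `x_0 ≺ x_1 ≺ ⋯ ≺ x_{n-1}`. -/
def DegLexLT {n : ℕ} (v w : FreeMonoid (Fin n)) : Prop :=
  List.Shortlex (· < ·) v.toList w.toList

/-- The reduction system `{(x_j x_i, f_{ji}) | i < j}` given by a table `f` of right-hand sides;
the values `f j i` with `j ≤ i` play no role. -/
def skewSystem {k : Type*} [Field k] {n : ℕ} (f : Fin n → Fin n → FreeAss k (Fin n)) :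
    ReductionSystem k (Fin n) :=
  {σ | ∃ i j : Fin n, i < j ∧ σ = (FreeMonoid.of j * FreeMonoid.of i, f j i)}

/-- `f_{ji} = c_{ij} x_i x_j + p_{ji}` with `c_{ij} ≠ 0` and all words of `p_{ji}` at most
`x_i x_j` in the degree-lexicographic order. -/
def IsSkewReductionSystem {k : Type*} [Field k] {n : ℕ}
    (f : Fin n → Fin n → FreeAss k (Fin n)) : Prop :=
  ∀ i j : Fin n, i < j → ∃ c : k, c ≠ 0 ∧ ∃ p : FreeAss k (Fin n),
    f j i = c • (var k i * var k j) + p ∧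
      ∀ w ∈ p.coeff.support,
        DegLexLT w (FreeMonoid.of i * FreeMonoid.of j) ∨ w = FreeMonoid.of i * FreeMonoid.of j

/-- Standard words `x_{j_1} ⋯ x_{j_s}`, `j_1 ≤ ⋯ ≤ j_s`. -/
def IsStandard {n : ℕ} (w : FreeMonoid (Fin n)) : Prop :=
  w.toList.Pairwise (· ≤ ·)

/-- `red`: replace the leftmost descent `x_j x_i` (`i < j`) of a word by `f_{ji}`. -/
def redList {k : Type*} [Field k] {n : ℕ} (f : Fin n → Fin n → FreeAss k (Fin n)) :
    List (Fin n) → FreeAss k (Fin n)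
  | [] => 1
  | [a] => var k a
  | a :: b :: l =>
      if b < a then f a b * term k (FreeMonoid.ofList l)
      else var k a * redList f (b :: l)

/-- `w` is the leading word of `p`. -/
def IsLeadingWord {k : Type*} [Field k] {n : ℕ} (p : FreeAss k (Fin n))
    (w : FreeMonoid (Fin n)) : Prop :=
  w ∈ p.coeff.support ∧ ∀ v ∈ p.coeff.support, v ≠ w → DegLexLT v w

open Classical in
/-- One pass through the loop of the algorithm "reduction to standard form", acting on the pair
`(p, g)` of the polynomial still to be treated and the standard polynomial found so far. If the
leading monomial `c • w` of `p` is standard it is moved from `p` to `g`; otherwise it is replaced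
in `p` by `c • red(w)`. If `p = 0` nothing happens. -/
def stredStep {k : Type*} [Field k] {n : ℕ} (f : Fin n → Fin n → FreeAss k (Fin n))
    (s : FreeAss k (Fin n) × FreeAss k (Fin n)) : FreeAss k (Fin n) × FreeAss k (Fin n) :=
  if h : ∃ w, IsLeadingWord s.1 w then
    let w := h.choose
    let m : FreeAss k (Fin n) := MonoidAlgebra.single w (s.1.coeff w)
    if IsStandard w then (s.1 - m, s.2 + m)
    else (s.1 - m + s.1.coeff w • redList f w.toList, s.2)
  else s

/-- `stred_Q(p) = g`: the algorithm started at `p` terminates, with output `g`. -/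
def IsStred {k : Type*} [Field k] {n : ℕ} (f : Fin n → Fin n → FreeAss k (Fin n))
    (p g : FreeAss k (Fin n)) : Prop :=
  ∃ N : ℕ, (stredStep f)^[N] (p, 0) = (0, g)

theorem stredStep_zero {k : Type*} [Field k] {n : ℕ} (f : Fin n → Fin n → FreeAss k (Fin n))
    (g : FreeAss k (Fin n)) : stredStep f (0, g) = (0, g) := by
  have h : ¬ ∃ w, IsLeadingWord (0 : FreeAss k (Fin n)) w := by
    rintro ⟨w, hw, -⟩
    simp at hw
  simp [stredStep, h]

/-- The output of the algorithm is unique, so `IsStred` is the graph of a partial function. -/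
theorem IsStred.unique {k : Type*} [Field k] {n : ℕ} {f : Fin n → Fin n → FreeAss k (Fin n)}
    {p g h : FreeAss k (Fin n)} (hg : IsStred f p g) (hh : IsStred f p h) : g = h := by
  obtain ⟨a, ha⟩ := hg
  obtain ⟨b, hb⟩ := hh
  have key : ∀ (m : ℕ) (q : FreeAss k (Fin n)), (stredStep f)^[m] (0, q) = (0, q) :=
    fun m q => Function.iterate_fixed (stredStep_zero f q) m
  have h1 : (stredStep f)^[a + b] (p, 0) = (0, h) := by
    rw [Function.iterate_add_apply, hb, key]
  have h2 : (stredStep f)^[a + b] (p, 0) = (0, g) := by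
    rw [add_comm, Function.iterate_add_apply, ha, key]
  exact (Prod.ext_iff.1 (h2.symm.trans h1)).2

/-! ### 3-dimensional skew polynomial algebras -/

/-- The homomorphism `k⟨x_0, x_1, x_2⟩ → A` that sends the variables to `x`, `y`, `z`. -/
def evalHom (k : Type*) [Field k] {A : Type*} [Ring A] [Algebra k A] (x y z : A) :
    FreeAss k (Fin 3) →ₐ[k] A :=
  MonoidAlgebra.lift k A (FreeMonoid (Fin 3)) (FreeMonoid.lift ![x, y, z])

/-- `A` is a 3-dimensional skew polynomial algebra in the variables `x`, `y`, `z`: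
it is generated by `x, y, z` with defining relations `yz - α zy = l`, `zx - β xz = m`,
`xy - γ yx = n`, where `α, β, γ ∈ k` are nonzero and `l, m, n ∈ k + k x + k y + k z`, and the
monomials `x^a y^b z^c` (`a, b, c ≥ 0`) are a `k`-basis of `A`. -/
structure IsSkewPolynomialAlgebra3 (k : Type*) [Field k] {A : Type*} [Ring A] [Algebra k A]
    (x y z : A) : Prop where
  surjective : Function.Surjective (evalHom k x y z)
  relations : ∃ α β γ : k, α ≠ 0 ∧ β ≠ 0 ∧ γ ≠ 0 ∧
    ∃ l ∈ Submodule.span k ({1, var k 0, var k 1, var k 2} : Set (FreeAss k (Fin 3))),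
    ∃ m ∈ Submodule.span k ({1, var k 0, var k 1, var k 2} : Set (FreeAss k (Fin 3))),
    ∃ n ∈ Submodule.span k ({1, var k 0, var k 1, var k 2} : Set (FreeAss k (Fin 3))),
      TwoSidedIdeal.ker (evalHom k x y z) = TwoSidedIdeal.span
        {var k 1 * var k 2 - α • (var k 2 * var k 1) - l,
         var k 2 * var k 0 - β • (var k 0 * var k 2) - m,
         var k 0 * var k 1 - γ • (var k 1 * var k 0) - n}
  linearIndependent :
    LinearIndependent k (fun e : ℕ × ℕ × ℕ => x ^ e.1 * y ^ e.2.1 * z ^ e.2.2)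
  span_eq_top :
    Submodule.span k (Set.range fun e : ℕ × ℕ × ℕ => x ^ e.1 * y ^ e.2.1 * z ^ e.2.2) = ⊤

/-! ### The Woronowicz algebra -/

/-- The ideal of defining relations `xz - ν⁴ zx = (1 + ν²) x`, `xy - ν² yx = ν z`,
`zy - ν⁴ yz = (1 + ν²) y`, where `x = x_0`, `y = x_1`, `z = x_2`. -/
def woronowiczIdeal {k : Type*} [Field k] (ν : k) : TwoSidedIdeal (FreeAss k (Fin 3)) :=
  TwoSidedIdeal.span
    {var k 0 * var k 2 - ν ^ 4 • (var k 2 * var k 0) - (1 + ν ^ 2) • var k 0,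
     var k 0 * var k 1 - ν ^ 2 • (var k 1 * var k 0) - ν • var k 2,
     var k 2 * var k 1 - ν ^ 4 • (var k 1 * var k 2) - (1 + ν ^ 2) • var k 1}

/-- The Woronowicz algebra `W_ν(sl(2, k))`. -/
abbrev Woronowicz {k : Type*} [Field k] (ν : k) : Type _ :=
  (woronowiczIdeal ν).ringCon.Quotient

/-- The classes of the variables: `x`, `y`, `z` are `gen ν 0`, `gen ν 1`, `gen ν 2`. -/
def Woronowicz.gen {k : Type*} [Field k] (ν : k) (i : Fin 3) : Woronowicz ν :=
  (woronowiczIdeal ν).ringCon.mk' (var k i)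

/-- The right-hand sides of the relations of the Woronowicz algebra, solved for the products
`x_j x_i`, `i < j`:
`x_1 x_0 = ν⁻² x_0 x_1 - ν⁻¹ x_2`, `x_2 x_0 = ν⁻⁴ x_0 x_2 - ν⁻⁴ (1 + ν²) x_0`,
`x_2 x_1 = ν⁴ x_1 x_2 + (1 + ν²) x_1`. -/
def woronowiczRule {k : Type*} [Field k] (ν : k) (j i : Fin 3) : FreeAss k (Fin 3) :=
  if j = 1 ∧ i = 0 then ν⁻¹ ^ 2 • (var k 0 * var k 1) - ν⁻¹ • var k 2
  else if j = 2 ∧ i = 0 then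
    ν⁻¹ ^ 4 • (var k 0 * var k 2) - (ν⁻¹ ^ 4 * (1 + ν ^ 2)) • var k 0
  else if j = 2 ∧ i = 1 then ν ^ 4 • (var k 1 * var k 2) + (1 + ν ^ 2) • var k 1
  else 0

end

end SkewPoly

open SkewPoly

namespace SkewPoly

/-! ### A representation on the space with basis the ordered monomials -/

noncomputable section

variable {k : Type*} [Field k]

/-- The coefficients of `z` and `1` in `(x ^ i y ^ j)⁻¹ z x ^ i y ^ j`. -/
def zCoeff (ν : k) : ℕ → ℕ → k × k
  | 0, 0 => (1, 0)
  | 0, j + 1 => (ν ^ 4 * (zCoeff ν 0 j).1, ν ^ 4 * (zCoeff ν 0 j).2 + (1 + ν ^ 2))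
  | i + 1, j => (ν⁻¹ ^ 4 * (zCoeff ν i j).1, ν⁻¹ ^ 4 * (zCoeff ν i j).2 - ν⁻¹ ^ 4 * (1 + ν ^ 2))

/-- The basis vector corresponding to `x ^ i y ^ j z ^ l`. -/
def monomialVec (k : Type*) [Field k] (i j l : ℕ) : ℕ × ℕ × ℕ →₀ k := Finsupp.single (i, j, l) 1

/-- Left multiplication by `x` on ordered monomials. -/
def opX (k : Type*) [Field k] : Module.End k (ℕ × ℕ × ℕ →₀ k) :=
  Finsupp.linearCombination k fun e => monomialVec k (e.1 + 1) e.2.1 e.2.2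

/-- Left multiplication by `z` on ordered monomials. -/
def opZ (ν : k) : Module.End k (ℕ × ℕ × ℕ →₀ k) :=
  Finsupp.linearCombination k fun e =>
    (zCoeff ν e.1 e.2.1).1 • monomialVec k e.1 e.2.1 (e.2.2 + 1) +
      (zCoeff ν e.1 e.2.1).2 • monomialVec k e.1 e.2.1 e.2.2

/-- The product of `y` and an ordered monomial. -/
def yMonomial (ν : k) : ℕ → ℕ → ℕ → (ℕ × ℕ × ℕ →₀ k)
  | 0, j, l => monomialVec k 0 (j + 1) l
  | i + 1, j, l => ν⁻¹ ^ 2 • opX k (yMonomial ν i j l) - ν⁻¹ • opZ ν (monomialVec k i j l)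

/-- Left multiplication by `y` on ordered monomials. -/
def opY (ν : k) : Module.End k (ℕ × ℕ × ℕ →₀ k) :=
  Finsupp.linearCombination k fun e => yMonomial ν e.1 e.2.1 e.2.2

theorem opX_monomialVec (i j l : ℕ) :
    opX k (monomialVec k i j l) = monomialVec k (i + 1) j l := by
  simp [opX, monomialVec]

theorem opZ_monomialVec (ν : k) (i j l : ℕ) :
    opZ ν (monomialVec k i j l) = (zCoeff ν i j).1 • monomialVec k i j (l + 1) +
      (zCoeff ν i j).2 • monomialVec k i j l := by
  simp [opZ, monomialVec]

theorem opY_monomialVec (ν : k) (i j l : ℕ) :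
    opY ν (monomialVec k i j l) = yMonomial ν i j l := by
  simp [opY, monomialVec]

theorem end_ext_monomialVec {S T : Module.End k (ℕ × ℕ × ℕ →₀ k)}
    (h : ∀ i j l, S (monomialVec k i j l) = T (monomialVec k i j l)) : S = T := by
  refine Finsupp.lhom_ext' fun e => LinearMap.ext_ring ?_
  exact h e.1 e.2.1 e.2.2

/-- Built into the model: the successor clause of `zCoeff` in i is this rule. -/
theorem opZ_mul_opX (ν : k) :
    opZ ν * opX k = ν⁻¹ ^ 4 • (opX k * opZ ν) - (ν⁻¹ ^ 4 * (1 + ν ^ 2)) • opX k := by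
  refine end_ext_monomialVec fun i j l => ?_
  simp only [Module.End.mul_apply, LinearMap.sub_apply, LinearMap.smul_apply, opX_monomialVec,
    opZ_monomialVec, map_add, map_smul, zCoeff]
  module

/-- Built into the model: the successor clause of `yMonomial` is this rule. -/
theorem opY_mul_opX (ν : k) :
    opY ν * opX k = ν⁻¹ ^ 2 • (opX k * opY ν) - ν⁻¹ • opZ ν := by
  refine end_ext_monomialVec fun i j l => ?_
  simp only [Module.End.mul_apply, LinearMap.sub_apply, LinearMap.smul_apply, opX_monomialVec,
    opY_monomialVec, yMonomial]

/-- The only relation not built in. For i = 0 it is the recursion of `zCoeff` in j; for i + 1,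
moving y and z past one x reduces both sides to the case i, as in resolving the overlap zyx. -/
theorem opZ_mul_opY {ν : k} (hν : ν ≠ 0) :
    opZ ν * opY ν = ν ^ 4 • (opY ν * opZ ν) + (1 + ν ^ 2) • opY ν := by
  refine end_ext_monomialVec fun i j l => ?_
  simp only [Module.End.mul_apply, LinearMap.add_apply, LinearMap.smul_apply]
  induction i with
  | zero =>
    simp only [opY_monomialVec, yMonomial, opZ_monomialVec, zCoeff, map_add, map_smul]
    module
  | succ i ih =>
    -- The two rules are needed at arbitrary vectors, since y and z do not send basis vectors to
    -- basis vectors.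
    have hZX := fun v => LinearMap.congr_fun (opZ_mul_opX ν) v
    have hYX := fun v => LinearMap.congr_fun (opY_mul_opX ν) v
    simp only [Module.End.mul_apply, LinearMap.sub_apply, LinearMap.smul_apply] at hZX hYX
    rw [← opX_monomialVec]
    simp only [hZX, hYX, map_sub, map_smul, map_add, ih]
    match_scalars <;> field_simp <;> ring

/-- The representation of the free algebra on the span of the ordered monomials. -/
def freeRep (ν : k) : FreeAss k (Fin 3) →ₐ[k] Module.End k (ℕ × ℕ × ℕ →₀ k) :=
  evalHom k (opX k) (opY ν) (opZ ν)

theorem evalHom_var {A : Type*} [Ring A] [Algebra k A] (x y z : A) (i : Fin 3) :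
    evalHom k x y z (var k i) = ![x, y, z] i := by
  simp [evalHom, var, term]

theorem woronowiczIdeal_le_ker_freeRep {ν : k} (hν : ν ≠ 0) :
    woronowiczIdeal ν ≤ TwoSidedIdeal.ker (freeRep ν) := by
  rw [woronowiczIdeal, TwoSidedIdeal.span_le]
  rintro p (rfl | rfl | rfl) <;>
    simp only [SetLike.mem_coe, TwoSidedIdeal.mem_ker, freeRep, map_sub, map_mul, map_smul,
      evalHom_var, Matrix.cons_val, opZ_mul_opX, opY_mul_opX, opZ_mul_opY hν] <;>
    match_scalars <;> field_simp <;> ring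

/-- The representation of the Woronowicz algebra on the span of the ordered monomials. -/
def woronowiczRep {ν : k} (hν : ν ≠ 0) :
    Woronowicz ν →ₐ[k] Module.End k (ℕ × ℕ × ℕ →₀ k) :=
  RingCon.liftₐ _ (freeRep ν) (TwoSidedIdeal.ringCon_le_iff.1 (woronowiczIdeal_le_ker_freeRep hν))

theorem woronowiczRep_gen {ν : k} (hν : ν ≠ 0) (i : Fin 3) :
    woronowiczRep hν (Woronowicz.gen ν i) = ![opX k, opY ν, opZ ν] i := by
  rw [← evalHom_var (k := k)]
  rfl

theorem opX_pow_monomialVec (a i j l : ℕ) :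
    (opX k ^ a) (monomialVec k i j l) = monomialVec k (i + a) j l := by
  induction a with
  | zero => simp
  | succ a ih => rw [pow_succ', Module.End.mul_apply, ih, opX_monomialVec, add_assoc]

/-- The case i = 0 suffices: in x^a y^b z^c applied to e_{000}, the powers of y act before any x. -/
theorem opY_pow_monomialVec (ν : k) (b j l : ℕ) :
    (opY ν ^ b) (monomialVec k 0 j l) = monomialVec k 0 (j + b) l := by
  induction b with
  | zero => simp
  | succ b ih => rw [pow_succ', Module.End.mul_apply, ih, opY_monomialVec, yMonomial, add_assoc]

theorem opZ_pow_monomialVec (ν : k) (c l : ℕ) :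
    (opZ ν ^ c) (monomialVec k 0 0 l) = monomialVec k 0 0 (l + c) := by
  induction c with
  | zero => simp
  | succ c ih =>
    rw [pow_succ', Module.End.mul_apply, ih, opZ_monomialVec, zCoeff, one_smul, zero_smul,
      add_zero, add_assoc]

/-- Letting an element act on e_{000} is a linear map that sends the monomials to distinct basis
vectors, and independence may be tested on images. -/
theorem linearIndependent_woronowicz_monomials {ν : k} (hν : ν ≠ 0) :
    LinearIndependent k fun e : ℕ × ℕ × ℕ =>
      Woronowicz.gen ν 0 ^ e.1 * Woronowicz.gen ν 1 ^ e.2.1 * Woronowicz.gen ν 2 ^ e.2.2 := by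
  refine LinearIndependent.of_comp
    ((woronowiczRep hν).toLinearMap.flip (monomialVec k 0 0 0)) ?_
  convert Finsupp.linearIndependent_single_one k (ℕ × ℕ × ℕ) using 1
  funext ⟨a, b, c⟩
  simp [woronowiczRep_gen, opZ_pow_monomialVec, opY_pow_monomialVec, opX_pow_monomialVec]
  rfl

/-! ### The ordered monomials span -/

/-- Identifies evaluation at the generators with the quotient map, from which surjectivity and the
kernel are read off. -/
theorem evalHom_gen (ν : k) :
    evalHom k (Woronowicz.gen ν 0) (Woronowicz.gen ν 1) (Woronowicz.gen ν 2) =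
      (woronowiczIdeal ν).ringCon.mkₐ k := by
  apply MonoidAlgebra.algHom_ext'
  · refine FreeMonoid.hom_eq fun i => ?_
    change evalHom k _ _ _ (var k i) = _
    rw [evalHom_var]
    fin_cases i <;> rfl
  · exact Subsingleton.elim _ _

theorem evalHom_gen_surjective (ν : k) : Function.Surjective
    (evalHom k (Woronowicz.gen ν 0) (Woronowicz.gen ν 1) (Woronowicz.gen ν 2)) := by
  rw [evalHom_gen]
  exact RingCon.mk'_surjective _

theorem ker_evalHom_gen (ν : k) : TwoSidedIdeal.ker
    (evalHom k (Woronowicz.gen ν 0) (Woronowicz.gen ν 1) (Woronowicz.gen ν 2)) =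
      woronowiczIdeal ν := by
  rw [evalHom_gen]
  exact TwoSidedIdeal.ker_ringCon_mk' _

theorem evalHom_gen_eq_zero {ν : k} {p : FreeAss k (Fin 3)} (hp : p ∈ woronowiczIdeal ν) :
    evalHom k (Woronowicz.gen ν 0) (Woronowicz.gen ν 1) (Woronowicz.gen ν 2) p = 0 := by
  rwa [← TwoSidedIdeal.mem_ker, ker_evalHom_gen]

theorem gen_two_mul_gen_zero {ν : k} (hν : ν ≠ 0) :
    Woronowicz.gen ν 2 * Woronowicz.gen ν 0 =
      ν⁻¹ ^ 4 • (Woronowicz.gen ν 0 * Woronowicz.gen ν 2) -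
        (ν⁻¹ ^ 4 * (1 + ν ^ 2)) • Woronowicz.gen ν 0 := by
  have h := evalHom_gen_eq_zero (ν := ν) (TwoSidedIdeal.subset_span (Set.mem_insert _ _))
  simp only [map_sub, map_mul, map_smul, evalHom_var, Matrix.cons_val] at h
  rw [sub_sub, sub_eq_zero] at h
  rw [h]
  match_scalars <;> field_simp
  ring

theorem gen_one_mul_gen_zero {ν : k} (hν : ν ≠ 0) :
    Woronowicz.gen ν 1 * Woronowicz.gen ν 0 =
      ν⁻¹ ^ 2 • (Woronowicz.gen ν 0 * Woronowicz.gen ν 1) - ν⁻¹ • Woronowicz.gen ν 2 := by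
  have h := evalHom_gen_eq_zero (ν := ν)
    (TwoSidedIdeal.subset_span (Set.mem_insert_of_mem _ (Set.mem_insert _ _)))
  simp only [map_sub, map_mul, map_smul, evalHom_var, Matrix.cons_val] at h
  rw [sub_sub, sub_eq_zero] at h
  rw [h]
  match_scalars <;> field_simp
  simp

theorem gen_two_mul_gen_one (ν : k) :
    Woronowicz.gen ν 2 * Woronowicz.gen ν 1 =
      ν ^ 4 • (Woronowicz.gen ν 1 * Woronowicz.gen ν 2) +
        (1 + ν ^ 2) • Woronowicz.gen ν 1 := by
  have h := evalHom_gen_eq_zero (ν := ν)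
    (TwoSidedIdeal.subset_span
      (Set.mem_insert_of_mem _ (Set.mem_insert_of_mem _ (Set.mem_singleton _))))
  simp only [map_sub, map_mul, map_smul, evalHom_var, Matrix.cons_val] at h
  rwa [sub_sub, sub_eq_zero] at h

/-- If `z` skew-commutes with `x` up to multiples of `x`, then the same holds for powers of `x`. -/
theorem exists_mul_pow_eq {A : Type*} [Ring A] [Algebra k A] {x z : A} {a b : k}
    (h : z * x = a • (x * z) + b • x) (n : ℕ) :
    ∃ c d : k, z * x ^ n = c • (x ^ n * z) + d • x ^ n := by
  induction n with
  | zero => exact ⟨1, 0, by simp⟩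
  | succ n ih =>
    obtain ⟨c, d, ih⟩ := ih
    -- From z x^(n+1) = c x^n (zx) + d x^(n+1) and zx = a xz + b x.
    refine ⟨c * a, c * b + d, ?_⟩
    rw [pow_succ, ← mul_assoc, ih, add_mul, smul_mul_assoc, mul_assoc, h]
    simp only [mul_add, mul_smul_comm, smul_mul_assoc, mul_assoc]
    module

theorem span_ordered_monomials_eq_top {A : Type*} [Ring A] [Algebra k A] {x y z : A}
    (hs : Function.Surjective (evalHom k x y z)) {a b c d e f : k}
    (hzx : z * x = a • (x * z) - b • x) (hzy : z * y = c • (y * z) + d • y)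
    (hyx : y * x = e • (x * y) - f • z) :
    Submodule.span k (Set.range fun e : ℕ × ℕ × ℕ => x ^ e.1 * y ^ e.2.1 * z ^ e.2.2) = ⊤ := by
  set S := Submodule.span k
    (Set.range fun e : ℕ × ℕ × ℕ => x ^ e.1 * y ^ e.2.1 * z ^ e.2.2) with hS
  have mono (i j l : ℕ) : x ^ i * y ^ j * z ^ l ∈ S := Submodule.subset_span ⟨(i, j, l), rfl⟩
  have closed {w : A} (hw : ∀ i j l : ℕ, w * (x ^ i * y ^ j * z ^ l) ∈ S) :
      ∀ v ∈ S, w * v ∈ S := by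
    intro v hv
    induction hv using Submodule.span_induction with
    | mem v hv => obtain ⟨⟨i, j, l⟩, rfl⟩ := hv; exact hw i j l
    | zero => simp
    | add u v _ _ hu hv => rw [mul_add]; exact S.add_mem hu hv
    | smul r v _ hv => rw [mul_smul_comm]; exact S.smul_mem r hv
  have hx : ∀ v ∈ S, x * v ∈ S := closed fun i j l => by
    simpa only [pow_succ', mul_assoc] using mono (i + 1) j l
  have hz : ∀ v ∈ S, z * v ∈ S := closed fun i j l => by
    obtain ⟨p, q, hp⟩ := exists_mul_pow_eq (hzx.trans (by rw [sub_eq_add_neg, ← neg_smul])) i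
    obtain ⟨r, s, hr⟩ := exists_mul_pow_eq hzy j
    have : z * (x ^ i * y ^ j * z ^ l) =
        (p * r) • (x ^ i * y ^ j * z ^ (l + 1)) + (p * s + q) • (x ^ i * y ^ j * z ^ l) := by
      rw [mul_assoc, ← mul_assoc z, hp, add_mul, smul_mul_assoc, mul_assoc _ z, ← mul_assoc z, hr]
      simp only [mul_add, add_mul, mul_smul_comm, smul_mul_assoc, mul_assoc, pow_succ']
      module
    rw [this]
    exact S.add_mem (S.smul_mem _ (mono _ _ _)) (S.smul_mem _ (mono _ _ _))
  -- Treated last: moving y past x leaves a term in z, so stability under x and z is already needed.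
  have hy : ∀ v ∈ S, y * v ∈ S := closed fun i j l => by
    induction i with
    | zero => simpa only [pow_succ', mul_assoc, pow_zero, one_mul] using mono 0 (j + 1) l
    | succ i ih =>
      have : y * (x ^ (i + 1) * y ^ j * z ^ l) =
          e • (x * (y * (x ^ i * y ^ j * z ^ l))) - f • (z * (x ^ i * y ^ j * z ^ l)) := by
        rw [pow_succ', mul_assoc, mul_assoc, ← mul_assoc y, hyx]
        simp only [sub_mul, smul_mul_assoc, mul_assoc]
      rw [this]
      exact S.sub_mem (S.smul_mem _ (hx _ ih)) (S.smul_mem _ (hz _ (mono _ _ _)))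
  -- Every element is a combination of words in x, y, z; a word lies in S by peeling off its first
  -- letter repeatedly.
  rw [eq_top_iff]
  rintro v -
  obtain ⟨p, rfl⟩ := hs v
  induction p using MonoidAlgebra.induction_linear with
  | zero => simp
  | add p q hp hq => rw [map_add]; exact S.add_mem hp hq
  | single w r =>
    rw [evalHom, MonoidAlgebra.lift_single]
    refine S.smul_mem r ?_
    induction w using FreeMonoid.inductionOn' with
    | one => simpa using mono 0 0 0
    | of_mul i w ih =>
      rw [map_mul, FreeMonoid.lift_eval_of]
      fin_cases i
      exacts [hx _ ih, hy _ ih, hz _ ih]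

theorem span_woronowicz_monomials {ν : k} (hν : ν ≠ 0) :
    Submodule.span k (Set.range fun e : ℕ × ℕ × ℕ =>
      Woronowicz.gen ν 0 ^ e.1 * Woronowicz.gen ν 1 ^ e.2.1 * Woronowicz.gen ν 2 ^ e.2.2) = ⊤ :=
  span_ordered_monomials_eq_top (evalHom_gen_surjective ν) (gen_two_mul_gen_zero hν)
    (gen_two_mul_gen_one ν) (gen_one_mul_gen_zero hν)

end

/-! ### The ideal of relations -/

section

variable {k : Type*} [Field k]

theorem span_triple_le_span_triple_of_smul {A : Type*} [Ring A] [Algebra k A]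
    {p q r p' q' r' : A} (hp : ∃ a : k, p = a • p') (hq : ∃ a : k, q = a • q')
    (hr : ∃ a : k, r = a • r') :
    TwoSidedIdeal.span {p, q, r} ≤ TwoSidedIdeal.span {p', q', r'} := by
  have key {u : A} (a : k) (hu : u ∈ ({p', q', r'} : Set A)) :
      a • u ∈ TwoSidedIdeal.span {p', q', r'} := by
    rw [← one_mul u, ← smul_mul_assoc]
    exact TwoSidedIdeal.mul_mem_left _ _ _ (TwoSidedIdeal.subset_span hu)
  obtain ⟨a, rfl⟩ := hp
  obtain ⟨b, rfl⟩ := hq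
  obtain ⟨c, rfl⟩ := hr
  rw [TwoSidedIdeal.span_le]
  rintro _ (rfl | rfl | rfl)
  · exact key a (by simp)
  · exact key b (by simp)
  · exact key c (by simp)

theorem span_triple_eq_span_triple_of_smul {A : Type*} [Ring A] [Algebra k A]
    {p q r p' q' r' : A} (hp : ∃ a : k, a ≠ 0 ∧ p = a • p') (hq : ∃ a : k, a ≠ 0 ∧ q = a • q')
    (hr : ∃ a : k, a ≠ 0 ∧ r = a • r') :
    TwoSidedIdeal.span {p, q, r} = TwoSidedIdeal.span {p', q', r'} := by
  have inv {u v : A} : (∃ a : k, a ≠ 0 ∧ u = a • v) → ∃ a : k, v = a • u := by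
    rintro ⟨a, ha, rfl⟩
    exact ⟨a⁻¹, by rw [inv_smul_smul₀ ha]⟩
  refine le_antisymm ?_ (span_triple_le_span_triple_of_smul (inv hp) (inv hq) (inv hr))
  obtain ⟨a, -, ha⟩ := hp
  obtain ⟨b, -, hb⟩ := hq
  obtain ⟨c, -, hc⟩ := hr
  exact span_triple_le_span_triple_of_smul ⟨a, ha⟩ ⟨b, hb⟩ ⟨c, hc⟩

theorem woronowiczIdeal_eq_span {ν : k} (hν : ν ≠ 0) :
    woronowiczIdeal ν = TwoSidedIdeal.span
      {var k 1 * var k 2 - ν⁻¹ ^ 4 • (var k 2 * var k 1) -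
          (-(ν⁻¹ ^ 4 * (1 + ν ^ 2))) • var k 1,
        var k 2 * var k 0 - ν⁻¹ ^ 4 • (var k 0 * var k 2) -
          (-(ν⁻¹ ^ 4 * (1 + ν ^ 2))) • var k 0,
        var k 0 * var k 1 - ν ^ 2 • (var k 1 * var k 0) - ν • var k 2} := by
  rw [woronowiczIdeal]
  -- Reorders the relations as zy, xz, xy, to match the right side term by term.
  conv_lhs => rw [Set.pair_comm, Set.insert_comm]
  refine span_triple_eq_span_triple_of_smul ⟨-ν ^ 4, by simpa, ?_⟩ ⟨-ν ^ 4, by simpa, ?_⟩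
    ⟨1, one_ne_zero, (one_smul k _).symm⟩ <;>
  · match_scalars <;> field_simp

theorem isSkewPolynomialAlgebra3_woronowicz {ν : k} (hν : ν ≠ 0) :
    IsSkewPolynomialAlgebra3 k
      (Woronowicz.gen ν 0) (Woronowicz.gen ν 1) (Woronowicz.gen ν 2) where
  surjective := evalHom_gen_surjective ν
  relations :=
    ⟨ν⁻¹ ^ 4, ν⁻¹ ^ 4, ν ^ 2, by simpa, by simpa, by simpa,
      _, Submodule.smul_mem _ _ (Submodule.subset_span (by simp)),
      _, Submodule.smul_mem _ _ (Submodule.subset_span (by simp)),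
      _, Submodule.smul_mem _ _ (Submodule.subset_span (by simp)),
      (ker_evalHom_gen ν).trans (woronowiczIdeal_eq_span hν)⟩
  linearIndependent := linearIndependent_woronowicz_monomials hν
  span_eq_top := span_woronowicz_monomials hν

theorem term_mul_term {X : Type*} (v w : FreeMonoid X) : term k v * term k w = term k (v * w) := by
  simp [term]

theorem var_eq_term (i : Fin 3) : var k i = term k (FreeMonoid.ofList [i]) := rfl

/-- The pairs are listed in the order of the relations in `woronowiczIdeal`, so that the generators
can be compared one by one. -/
theorem mem_skewSystem_fin_three {f : Fin 3 → Fin 3 → FreeAss k (Fin 3)}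
    {σ : FreeMonoid (Fin 3) × FreeAss k (Fin 3)} :
    σ ∈ skewSystem f ↔ σ = (FreeMonoid.of 2 * FreeMonoid.of 0, f 2 0) ∨
      σ = (FreeMonoid.of 1 * FreeMonoid.of 0, f 1 0) ∨
      σ = (FreeMonoid.of 2 * FreeMonoid.of 1, f 2 1) := by
  constructor
  · rintro ⟨i, j, hij, rfl⟩
    fin_cases i <;> fin_cases j <;> simp at hij ⊢
  · rintro (rfl | rfl | rfl)
    exacts [⟨0, 2, by decide, rfl⟩, ⟨0, 1, by decide, rfl⟩, ⟨1, 2, by decide, rfl⟩]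

theorem woronowiczRule_one_zero (ν : k) :
    woronowiczRule ν 1 0 = ν⁻¹ ^ 2 • (var k 0 * var k 1) - ν⁻¹ • var k 2 := by
  simp [woronowiczRule]

theorem woronowiczRule_two_zero (ν : k) :
    woronowiczRule ν 2 0 =
      ν⁻¹ ^ 4 • (var k 0 * var k 2) - (ν⁻¹ ^ 4 * (1 + ν ^ 2)) • var k 0 := by
  simp [woronowiczRule]

theorem woronowiczRule_two_one (ν : k) :
    woronowiczRule ν 2 1 = ν ^ 4 • (var k 1 * var k 2) + (1 + ν ^ 2) • var k 1 := by
  simp [woronowiczRule]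

theorem woronowiczIdeal_eq_ideal_skewSystem {ν : k} (hν : ν ≠ 0) :
    woronowiczIdeal ν = (skewSystem (woronowiczRule ν)).ideal := by
  have h : {p | ∃ σ ∈ skewSystem (woronowiczRule ν), p = term k σ.1 - σ.2} =
      {var k 2 * var k 0 - woronowiczRule ν 2 0, var k 1 * var k 0 - woronowiczRule ν 1 0,
        var k 2 * var k 1 - woronowiczRule ν 2 1} := by
    ext p
    simp only [mem_skewSystem_fin_three, Set.mem_ofPred_eq, or_and_right, exists_or,
      exists_eq_left, Set.mem_insert_iff, Set.mem_singleton_iff, var, term_mul_term]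
  rw [ReductionSystem.ideal, h, woronowiczIdeal, woronowiczRule_two_zero, woronowiczRule_one_zero,
    woronowiczRule_two_one]
  refine span_triple_eq_span_triple_of_smul ⟨-ν ^ 4, by simpa, ?_⟩ ⟨-ν ^ 2, by simpa, ?_⟩
    ⟨1, one_ne_zero, ?_⟩
  · match_scalars <;> field_simp
  · match_scalars <;> field_simp
  · module

/-! ### Ambiguities -/

theorem FreeMonoid.of_mul_of_eq_mul {X : Type*} {a b : X} {A B : FreeMonoid X}
    (h : FreeMonoid.of a * FreeMonoid.of b = A * B) (hA : A ≠ 1) (hB : B ≠ 1) :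
    A = FreeMonoid.of a ∧ B = FreeMonoid.of b := by
  change [a, b] = A.toList ++ B.toList at h
  obtain ⟨c, l, hc⟩ := List.exists_cons_of_ne_nil (l := A.toList) hA
  obtain ⟨d, m, hd⟩ := List.exists_cons_of_ne_nil (l := B.toList) hB
  rw [hc, hd] at h
  rw [List.cons_append, List.cons.injEq] at h
  obtain ⟨rfl, h⟩ := h
  cases l with
  | nil =>
    simp only [List.nil_append, List.cons.injEq] at h
    obtain ⟨rfl, rfl⟩ := h
    exact ⟨hc, hd⟩
  | cons e l => simp at h

/-- Two-letter words can only share one letter, which gives indices j > i > i'; among three indices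
this is 2 > 1 > 0. -/
theorem isOverlapAmbiguity_skewSystem_fin_three (f : Fin 3 → Fin 3 → FreeAss k (Fin 3))
    (σ τ : FreeMonoid (Fin 3) × FreeAss k (Fin 3)) (A B C : FreeMonoid (Fin 3)) :
    (skewSystem f).IsOverlapAmbiguity σ τ A B C ↔
      σ = (FreeMonoid.of 2 * FreeMonoid.of 1, f 2 1) ∧
      τ = (FreeMonoid.of 1 * FreeMonoid.of 0, f 1 0) ∧
      A = FreeMonoid.of 2 ∧ B = FreeMonoid.of 1 ∧ C = FreeMonoid.of 0 := by
  constructor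
  · rintro ⟨⟨i, j, hij, rfl⟩, ⟨i', j', hij', rfl⟩, hA, hB, hC, hσ, hτ⟩
    obtain ⟨rfl, rfl⟩ := FreeMonoid.of_mul_of_eq_mul hσ hA hB
    obtain ⟨h, rfl⟩ := FreeMonoid.of_mul_of_eq_mul hτ hB hC
    obtain rfl := FreeMonoid.of_injective h
    obtain ⟨rfl, rfl, rfl⟩ : i' = 0 ∧ i = 1 ∧ j = 2 := by omega
    exact ⟨rfl, rfl, rfl, rfl, rfl⟩
  · rintro ⟨rfl, rfl, rfl, rfl, rfl⟩
    exact ⟨⟨1, 2, by decide, rfl⟩, ⟨0, 1, by decide, rfl⟩, FreeMonoid.of_ne_one _,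
      FreeMonoid.of_ne_one _, FreeMonoid.of_ne_one _, rfl, rfl⟩

/-- Equal lengths force A = C = 1, and a pair of the system is determined by its word. -/
theorem not_isInclusionAmbiguity_skewSystem {n : ℕ} (f : Fin n → Fin n → FreeAss k (Fin n))
    (σ τ : FreeMonoid (Fin n) × FreeAss k (Fin n)) (A B C : FreeMonoid (Fin n)) :
    ¬ (skewSystem f).IsInclusionAmbiguity σ τ A B C := by
  rintro ⟨⟨i, j, hij, rfl⟩, ⟨i', j', hij', rfl⟩, hne, rfl, h⟩
  have hlen := congrArg FreeMonoid.length h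
  simp only [FreeMonoid.length_mul, FreeMonoid.length_of] at hlen
  obtain rfl : A = 1 := FreeMonoid.length_eq_zero.1 (by omega)
  obtain rfl : C = 1 := FreeMonoid.length_eq_zero.1 (by omega)
  change [j, i] = [j', i'] ++ [] at h
  simp only [List.append_nil, List.cons.injEq, and_true] at h
  obtain ⟨rfl, rfl⟩ := h
  exact hne rfl

/-! ### Reductions -/

theorem reduction_add {X : Type*} (A : FreeMonoid X) (σ : FreeMonoid X × FreeAss k X)
    (B : FreeMonoid X) (p q : FreeAss k X) :
    reduction A σ B (p + q) = reduction A σ B p + reduction A σ B q :=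
  map_add _ p.coeff q.coeff

theorem reduction_smul {X : Type*} (A : FreeMonoid X) (σ : FreeMonoid X × FreeAss k X)
    (B : FreeMonoid X) (c : k) (p : FreeAss k X) :
    reduction A σ B (c • p) = c • reduction A σ B p :=
  map_smul _ c p.coeff

open Classical in
theorem reduction_term {X : Type*} (A : FreeMonoid X) (σ : FreeMonoid X × FreeAss k X)
    (B w : FreeMonoid X) :
    reduction A σ B (term k w) =
      if w = A * σ.1 * B then term k A * σ.2 * term k B else term k w := by
  simp [reduction, term]

theorem ReductionSystem.Reduces.of_reduction {X : Type*} {Q : ReductionSystem k X}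
    {σ : FreeMonoid X × FreeAss k X} (hσ : σ ∈ Q) (A B : FreeMonoid X) {p q r : FreeAss k X}
    (hq : reduction A σ B p = q) (h : Q.Reduces q r) : Q.Reduces p r :=
  Relation.ReflTransGen.head ⟨σ, hσ, A, B, hq.symm⟩ h

end

/-! ### Standard forms -/

section

variable {k : Type*} [Field k]

/-- Asymmetry of the order is what makes leading words unique. -/
theorem not_degLexLT_and_degLexLT {n : ℕ} {v w : FreeMonoid (Fin n)} (h : DegLexLT v w)
    (h' : DegLexLT w v) : False := by
  rw [DegLexLT, List.shortlex_def] at h h'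
  rcases h with h | ⟨hl, h⟩
  · omega
  · exact (List.Lex.asymm (r := (· < ·))).asymm _ _ h (h'.resolve_left (by omega)).2

theorem degLexLT_of_length_lt {n : ℕ} {v w : FreeMonoid (Fin n)} (h : v.length < w.length) :
    DegLexLT v w :=
  List.Shortlex.of_length_lt h

/-- All words of `q` are strictly below `w`. -/
def WordsBelow {n : ℕ} (q : FreeAss k (Fin n)) (w : FreeMonoid (Fin n)) : Prop :=
  ∀ v ∈ q.coeff.support, DegLexLT v w

theorem wordsBelow_zero {n : ℕ} (w : FreeMonoid (Fin n)) : WordsBelow (0 : FreeAss k (Fin n)) w :=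
  fun v hv => by simp at hv

theorem WordsBelow.add {n : ℕ} {p q : FreeAss k (Fin n)} {w : FreeMonoid (Fin n)}
    (hp : WordsBelow p w) (hq : WordsBelow q w) : WordsBelow (p + q) w := fun v hv => by
  classical
  exact (Finset.mem_union.1 (Finsupp.support_add hv)).elim (hp v) (hq v)

/-- Length alone decides every comparison needed later: no tail contains a word as long as the
leading one. -/
theorem wordsBelow_smul_term {n : ℕ} (c : k) {v w : FreeMonoid (Fin n)}
    (h : v.length < w.length) : WordsBelow (c • term k v) w := fun u hu => by
  have : u ∈ (Finsupp.single v (1 : k)).support := Finsupp.support_smul hu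
  rw [Finset.mem_singleton.1 (Finsupp.support_single_subset this)]
  exact degLexLT_of_length_lt h

theorem WordsBelow.coeff_self {n : ℕ} {q : FreeAss k (Fin n)} {w : FreeMonoid (Fin n)}
    (h : WordsBelow q w) : q.coeff w = 0 := by
  by_contra hw
  have := h w (Finsupp.mem_support_iff.2 hw)
  exact not_degLexLT_and_degLexLT this this

theorem WordsBelow.coeff_smul_term_add {n : ℕ} {q : FreeAss k (Fin n)} {w : FreeMonoid (Fin n)}
    (h : WordsBelow q w) (c : k) : (c • term k w + q).coeff w = c := by
  simp [term, h.coeff_self]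

theorem WordsBelow.isLeadingWord_iff {n : ℕ} {q : FreeAss k (Fin n)} {w : FreeMonoid (Fin n)}
    (h : WordsBelow q w) {c : k} (hc : c ≠ 0) {v : FreeMonoid (Fin n)} :
    IsLeadingWord (c • term k w + q) v ↔ v = w := by
  have hw : IsLeadingWord (c • term k w + q) w := by
    refine ⟨Finsupp.mem_support_iff.2 (by rwa [h.coeff_smul_term_add]), fun u hu hne => ?_⟩
    refine h u (Finsupp.mem_support_iff.2 fun h0 => Finsupp.mem_support_iff.1 hu ?_)
    simp [term, h0, Finsupp.single_eq_of_ne hne]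
  refine ⟨fun hv => ?_, fun h => h ▸ hw⟩
  by_contra hne
  exact not_degLexLT_and_degLexLT (hw.2 v hv.1 hne) (hv.2 w hw.1 (Ne.symm hne))

-- `stredStep` picks a leading word by choice; uniqueness forces the pick to be w.
open Classical in
theorem WordsBelow.stredStep_eq {n : ℕ} {q : FreeAss k (Fin n)} {w : FreeMonoid (Fin n)}
    (h : WordsBelow q w) {c : k} (hc : c ≠ 0) (f : Fin n → Fin n → FreeAss k (Fin n))
    (g : FreeAss k (Fin n)) :
    stredStep f (c • term k w + q, g) =
      if IsStandard w then (q, g + c • term k w) else (q + c • redList f w.toList, g) := by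
  have hex : ∃ v, IsLeadingWord (c • term k w + q) v := ⟨w, (h.isLeadingWord_iff hc).2 rfl⟩
  have hw : hex.choose = w := (h.isLeadingWord_iff hc).1 hex.choose_spec
  have hm : (MonoidAlgebra.single w c : FreeAss k (Fin n)) = c • term k w := by simp [term]
  simp only [stredStep, dif_pos hex, hw, h.coeff_smul_term_add, hm, add_sub_cancel_left]

/-- The algorithm "reduction to standard form" started in the state `(p, g)` terminates with
output `r`. -/
def StredTerminates {n : ℕ} (f : Fin n → Fin n → FreeAss k (Fin n)) (p g r : FreeAss k (Fin n)) :
    Prop :=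
  ∃ N : ℕ, (stredStep f)^[N] (p, g) = (0, r)

theorem stredTerminates_zero {n : ℕ} (f : Fin n → Fin n → FreeAss k (Fin n))
    {g r : FreeAss k (Fin n)} (h : g = r) : StredTerminates f 0 g r := ⟨0, by rw [h]; rfl⟩

theorem StredTerminates.of_isStandard {n : ℕ} {f : Fin n → Fin n → FreeAss k (Fin n)}
    {p g r : FreeAss k (Fin n)} (c : k) (w : FreeMonoid (Fin n)) (q : FreeAss k (Fin n))
    (hp : p = c • term k w + q) (hc : c ≠ 0) (hq : WordsBelow q w) (hw : IsStandard w)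
    (h : StredTerminates f q (g + c • term k w) r) : StredTerminates f p g r := by
  obtain ⟨N, hN⟩ := h
  refine ⟨N + 1, ?_⟩
  rw [Function.iterate_succ_apply, hp, hq.stredStep_eq hc, if_pos hw, hN]

theorem StredTerminates.of_not_isStandard {n : ℕ} {f : Fin n → Fin n → FreeAss k (Fin n)}
    {p g r : FreeAss k (Fin n)} (c : k) (w : FreeMonoid (Fin n)) (q : FreeAss k (Fin n))
    (hp : p = c • term k w + q) (hc : c ≠ 0) (hq : WordsBelow q w) (hw : ¬ IsStandard w)
    (h : StredTerminates f (q + c • redList f w.toList) g r) : StredTerminates f p g r := by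
  obtain ⟨N, hN⟩ := h
  refine ⟨N + 1, ?_⟩
  rw [Function.iterate_succ_apply, hp, hq.stredStep_eq hc, if_neg hw, hN]

/-! ### The skew reduction system of the Woronowicz algebra -/

theorem term_one {X : Type*} : term k (1 : FreeMonoid X) = 1 := rfl

theorem term_ofList_mul_term_ofList (l m : List (Fin 3)) :
    term k (FreeMonoid.ofList l) * term k (FreeMonoid.ofList m) =
      term k (FreeMonoid.ofList (l ++ m)) :=
  term_mul_term _ _

theorem isSkewReductionSystem_woronowiczRule {ν : k} (hν : ν ≠ 0) :
    IsSkewReductionSystem (woronowiczRule ν) := by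
  -- All three rules have this shape: a multiple of x_i x_j plus a multiple of a single variable.
  have key (i j m : Fin 3) (c d : k) (hc : c ≠ 0) :
      ∃ c' : k, c' ≠ 0 ∧ ∃ p : FreeAss k (Fin 3),
        c • (var k i * var k j) + d • var k m = c' • (var k i * var k j) + p ∧
          ∀ w ∈ p.coeff.support, DegLexLT w (FreeMonoid.of i * FreeMonoid.of j) ∨
            w = FreeMonoid.of i * FreeMonoid.of j :=
    ⟨c, hc, _, rfl, fun w hw => Or.inl (wordsBelow_smul_term d (by simp) w hw)⟩
  intro i j hij
  obtain ⟨rfl, rfl⟩ | ⟨rfl, rfl⟩ | ⟨rfl, rfl⟩ :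
      i = 0 ∧ j = 1 ∨ i = 0 ∧ j = 2 ∨ i = 1 ∧ j = 2 := by omega
  · rw [woronowiczRule_one_zero, sub_eq_add_neg, ← neg_smul]
    exact key _ _ _ _ _ (by simpa)
  · rw [woronowiczRule_two_zero, sub_eq_add_neg, ← neg_smul]
    exact key _ _ _ _ _ (by simpa)
  · rw [woronowiczRule_two_one]
    exact key _ _ _ _ _ (by simpa)

/-- Signs are absorbed into scalars, so that the result is a sum of scalar multiples of words, ready
for linearity and for splitting off a leading term. -/
theorem term_mul_woronowiczRule_one_zero_mul_term (ν : k) (l m : List (Fin 3)) :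
    term k (.ofList l) * woronowiczRule ν 1 0 * term k (.ofList m) =
      ν⁻¹ ^ 2 • term k (.ofList (l ++ 0 :: 1 :: m)) + (-ν⁻¹) • term k (.ofList (l ++ 2 :: m)) := by
  rw [woronowiczRule_one_zero, sub_eq_add_neg, ← neg_smul]
  simp only [var_eq_term, mul_add, add_mul, mul_smul_comm, smul_mul_assoc,
    term_ofList_mul_term_ofList, List.append_assoc, List.cons_append, List.nil_append]

theorem term_mul_woronowiczRule_two_zero_mul_term (ν : k) (l m : List (Fin 3)) :
    term k (.ofList l) * woronowiczRule ν 2 0 * term k (.ofList m) =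
      ν⁻¹ ^ 4 • term k (.ofList (l ++ 0 :: 2 :: m)) +
        (-(ν⁻¹ ^ 4 * (1 + ν ^ 2))) • term k (.ofList (l ++ 0 :: m)) := by
  rw [woronowiczRule_two_zero, sub_eq_add_neg, ← neg_smul]
  simp only [var_eq_term, mul_add, add_mul, mul_smul_comm, smul_mul_assoc,
    term_ofList_mul_term_ofList, List.append_assoc, List.cons_append, List.nil_append]

theorem term_mul_woronowiczRule_two_one_mul_term (ν : k) (l m : List (Fin 3)) :
    term k (.ofList l) * woronowiczRule ν 2 1 * term k (.ofList m) =
      ν ^ 4 • term k (.ofList (l ++ 1 :: 2 :: m)) +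
        (1 + ν ^ 2) • term k (.ofList (l ++ 1 :: m)) := by
  rw [woronowiczRule_two_one]
  simp only [var_eq_term, mul_add, add_mul, mul_smul_comm, smul_mul_assoc,
    term_ofList_mul_term_ofList, List.append_assoc, List.cons_append, List.nil_append]

theorem woronowiczRule_two_one_mul_var_zero (ν : k) :
    woronowiczRule ν 2 1 * var k 0 =
      ν ^ 4 • term k (.ofList [1, 2, 0]) + (1 + ν ^ 2) • term k (.ofList [1, 0]) := by
  have h := term_mul_woronowiczRule_two_one_mul_term ν [] [0]
  rwa [FreeMonoid.ofList_nil, term_one, one_mul] at h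

theorem var_two_mul_woronowiczRule_one_zero (ν : k) :
    var k 2 * woronowiczRule ν 1 0 =
      ν⁻¹ ^ 2 • term k (.ofList [2, 0, 1]) + (-ν⁻¹) • term k (.ofList [2, 2]) := by
  have h := term_mul_woronowiczRule_one_zero_mul_term ν [2] []
  rwa [FreeMonoid.ofList_nil, term_one, mul_one] at h

theorem woronowicz_standardForm_eq (ν : k) :
    ν⁻¹ ^ 2 • (var k 0 * var k 1 * var k 2) - ν⁻¹ • var k 2 ^ 2 =
      ν⁻¹ ^ 2 • term k (.ofList [(0 : Fin 3), 1, 2]) +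
        (-ν⁻¹) • term k (.ofList [(2 : Fin 3), 2]) := by
  rw [pow_two (var k (2 : Fin 3)), sub_eq_add_neg, ← neg_smul]
  simp only [var_eq_term, term_ofList_mul_term_ofList, List.cons_append, List.nil_append]

/-- With words as lists the test is a decidable equality, settled by `decide` on concrete words. -/
theorem reduction_ofList (l m u : List (Fin 3)) (j i : Fin 3) (f : FreeAss k (Fin 3)) :
    reduction (.ofList l) (FreeMonoid.of j * FreeMonoid.of i, f) (.ofList m)
        (term k (.ofList u)) =
      if u = l ++ j :: i :: m then term k (.ofList l) * f * term k (.ofList m)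
      else term k (.ofList u) := by
  have h : (FreeMonoid.ofList u = FreeMonoid.ofList l * (FreeMonoid.of j * FreeMonoid.of i) *
      FreeMonoid.ofList m) ↔ u = l ++ j :: i :: m := by
    change u = (l ++ [j, i]) ++ m ↔ _
    rw [List.append_assoc, List.cons_append, List.cons_append, List.nil_append]
  rw [reduction_term]
  simp only [h]

theorem overlapSolvable_woronowiczRule {ν : k} (hν : ν ≠ 0) :
    (skewSystem (woronowiczRule ν)).OverlapSolvable
      (FreeMonoid.of 2 * FreeMonoid.of 1, woronowiczRule ν 2 1)
      (FreeMonoid.of 1 * FreeMonoid.of 0, woronowiczRule ν 1 0)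
      (FreeMonoid.of 2) (FreeMonoid.of 0) := by
  have h10 : (FreeMonoid.of 1 * FreeMonoid.of 0, woronowiczRule ν 1 0) ∈
    skewSystem (woronowiczRule ν) := ⟨0, 1, by decide, rfl⟩
  have h20 : (FreeMonoid.of 2 * FreeMonoid.of 0, woronowiczRule ν 2 0) ∈
    skewSystem (woronowiczRule ν) := ⟨0, 2, by decide, rfl⟩
  have h21 : (FreeMonoid.of 2 * FreeMonoid.of 1, woronowiczRule ν 2 1) ∈
    skewSystem (woronowiczRule ν) := ⟨1, 2, by decide, rfl⟩
  refine ⟨ν⁻¹ ^ 2 • term k (.ofList [(0 : Fin 3), 1, 2]) +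
    (-ν⁻¹) • term k (.ofList [(2 : Fin 3), 2]), ?_, ?_⟩
  -- Reducing zx in ν⁴ yzx + (1 + ν²) yx creates -(1 + ν²) yx, which cancels and leaves exactly yxz.
  · refine .of_reduction h20 (.ofList [1]) (.ofList [])
      (q := term k (.ofList [(1 : Fin 3), 0, 2])) ?_
      (.of_reduction h10 (.ofList []) (.ofList [2]) ?_ .refl)
    · change reduction _ _ _ (woronowiczRule ν 2 1 * var k 0) = _
      rw [woronowiczRule_two_one_mul_var_zero, reduction_add, reduction_smul, reduction_smul,
        reduction_ofList, if_pos (by decide), reduction_ofList, if_neg (by decide),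
        term_mul_woronowiczRule_two_zero_mul_term]
      simp only [List.cons_append, List.nil_append]
      match_scalars <;> field_simp
      ring
    · rw [reduction_ofList, if_pos (by decide), term_mul_woronowiczRule_one_zero_mul_term]
      rfl
  -- Reducing zx in zxy creates a multiple of xy, which cancels once zy is reduced in xzy.
  · refine .of_reduction h20 (.ofList []) (.ofList [1])
      (q := (ν⁻¹ ^ 2 * ν⁻¹ ^ 4) • term k (.ofList [(0 : Fin 3), 2, 1]) +
        (-(ν⁻¹ ^ 2 * (ν⁻¹ ^ 4 * (1 + ν ^ 2)))) • term k (.ofList [(0 : Fin 3), 1]) +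
        (-ν⁻¹) • term k (.ofList [(2 : Fin 3), 2])) ?_
      (.of_reduction h21 (.ofList [0]) (.ofList []) ?_ .refl)
    · change reduction _ _ _ (var k 2 * woronowiczRule ν 1 0) = _
      rw [var_two_mul_woronowiczRule_one_zero, reduction_add, reduction_smul, reduction_smul,
        reduction_ofList, if_pos (by decide), reduction_ofList, if_neg (by decide),
        term_mul_woronowiczRule_two_zero_mul_term]
      simp only [List.nil_append]
      module
    · rw [reduction_add, reduction_add, reduction_smul, reduction_smul, reduction_smul,
        reduction_ofList, if_pos (by decide), reduction_ofList, if_neg (by decide),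
        reduction_ofList, if_neg (by decide), term_mul_woronowiczRule_two_one_mul_term]
      simp only [List.cons_append, List.nil_append]
      match_scalars <;> field_simp
      ring

/-- As `l ++ [b]` does not decrease, the recursion passes over `l` and meets its first descent at b,
a. -/
theorem redList_append {n : ℕ} (f : Fin n → Fin n → FreeAss k (Fin n)) {l : List (Fin n)}
    {b a : Fin n} (m : List (Fin n)) (hl : (l ++ [b]).Pairwise (· ≤ ·)) (hab : a < b) :
    redList f (l ++ b :: a :: m) =
      term k (.ofList l) * f b a * term k (.ofList m) := by
  induction l with
  | nil => rw [List.nil_append, redList, if_pos hab, FreeMonoid.ofList_nil, term_one, one_mul]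
  | cons c l ih =>
    rw [List.cons_append, List.pairwise_cons] at hl
    have step : redList f (c :: (l ++ b :: a :: m)) = var k c * redList f (l ++ b :: a :: m) := by
      -- `redList` inspects two letters, and the one after c is b or the head of `l`.
      cases l with
      | nil => rw [List.nil_append, redList, if_neg (hl.1 b (by simp)).not_gt]
      | cons d l => rw [List.cons_append, redList, if_neg (hl.1 d (by simp)).not_gt]
    rw [List.cons_append, step, ih hl.2, ← mul_assoc, ← mul_assoc]
    congr 2
    exact term_mul_term _ _

/-- The successive leading words are zxy, xzy, xyz, zz; the last two are standard. -/
theorem isStred_var_two_mul_woronowiczRule {ν : k} (hν : ν ≠ 0) :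
    IsStred (woronowiczRule ν) (var k 2 * woronowiczRule ν 1 0)
      (ν⁻¹ ^ 2 • (var k 0 * var k 1 * var k 2) - ν⁻¹ • var k 2 ^ 2) := by
  have red1 : redList (woronowiczRule ν) [2, 0, 1] = _ :=
    (redList_append _ (l := []) [1] (by simp) (by decide)).trans
      (term_mul_woronowiczRule_two_zero_mul_term ν [] [1])
  have red2 : redList (woronowiczRule ν) [0, 2, 1] = _ :=
    (redList_append _ (l := [0]) [] (by simp) (by decide)).trans
      (term_mul_woronowiczRule_two_one_mul_term ν [0] [])
  rw [woronowicz_standardForm_eq]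
  refine StredTerminates.of_not_isStandard (ν⁻¹ ^ 2) (.ofList [2, 0, 1])
    ((-ν⁻¹) • term k (.ofList [2, 2])) (var_two_mul_woronowiczRule_one_zero ν) (by simpa)
    (wordsBelow_smul_term _ (by decide)) (by simp [IsStandard]) ?_
  refine StredTerminates.of_not_isStandard (ν⁻¹ ^ 2 * ν⁻¹ ^ 4) (.ofList [0, 2, 1])
    ((-(ν⁻¹ ^ 2 * (ν⁻¹ ^ 4 * (1 + ν ^ 2)))) • term k (.ofList [0, 1]) +
      (-ν⁻¹) • term k (.ofList [2, 2])) ?_ (by simpa)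
    (.add (wordsBelow_smul_term _ (by decide)) (wordsBelow_smul_term _ (by decide)))
    (by simp [IsStandard]) ?_
  · rw [FreeMonoid.toList_ofList, red1]
    simp only [List.nil_append]
    module
  refine StredTerminates.of_isStandard (ν⁻¹ ^ 2) (.ofList [0, 1, 2])
    ((-ν⁻¹) • term k (.ofList [2, 2])) ?_ (by simpa) (wordsBelow_smul_term _ (by decide))
    (by simp [IsStandard]) ?_
  · rw [FreeMonoid.toList_ofList, red2]
    simp only [List.cons_append, List.nil_append]
    match_scalars <;> field_simp
    ring
  exact StredTerminates.of_isStandard (-ν⁻¹) (.ofList [2, 2]) 0 (by simp) (by simpa)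
    (wordsBelow_zero _) (by simp [IsStandard]) (stredTerminates_zero _ (by module))

/-- The successive leading words are yzx, yxz, xyz, zz; the last two are standard. -/
theorem isStred_woronowiczRule_mul_var_zero {ν : k} (hν : ν ≠ 0) :
    IsStred (woronowiczRule ν) (woronowiczRule ν 2 1 * var k 0)
      (ν⁻¹ ^ 2 • (var k 0 * var k 1 * var k 2) - ν⁻¹ • var k 2 ^ 2) := by
  have red1 : redList (woronowiczRule ν) [1, 2, 0] = _ :=
    (redList_append _ (l := [1]) [] (by simp) (by decide)).trans
      (term_mul_woronowiczRule_two_zero_mul_term ν [1] [])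
  have red2 : redList (woronowiczRule ν) [1, 0, 2] = _ :=
    (redList_append _ (l := []) [2] (by simp) (by decide)).trans
      (term_mul_woronowiczRule_one_zero_mul_term ν [] [2])
  rw [woronowicz_standardForm_eq]
  refine StredTerminates.of_not_isStandard (ν ^ 4) (.ofList [1, 2, 0])
    ((1 + ν ^ 2) • term k (.ofList [1, 0])) (woronowiczRule_two_one_mul_var_zero ν) (by simpa)
    (wordsBelow_smul_term _ (by decide)) (by simp [IsStandard]) ?_
  -- Coefficient 1 is ν⁴ν⁻⁴, and the remainder is 0 because the yx terms cancel.
  refine StredTerminates.of_not_isStandard 1 (.ofList [1, 0, 2]) 0 ?_ one_ne_zero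
    (wordsBelow_zero _) (by simp [IsStandard]) ?_
  · rw [FreeMonoid.toList_ofList, red1]
    simp only [List.cons_append, List.nil_append]
    match_scalars <;> field_simp
    ring
  refine StredTerminates.of_isStandard (ν⁻¹ ^ 2) (.ofList [0, 1, 2])
    ((-ν⁻¹) • term k (.ofList [2, 2])) ?_ (by simpa) (wordsBelow_smul_term _ (by decide))
    (by simp [IsStandard]) ?_
  · rw [FreeMonoid.toList_ofList, red2]
    simp only [List.nil_append]
    module
  exact StredTerminates.of_isStandard (-ν⁻¹) (.ofList [2, 2]) 0 (by simp) (by simpa)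
    (wordsBelow_zero _) (by simp [IsStandard]) (stredTerminates_zero _ (by module))

end

end SkewPoly

open SkewPoly
theorem mainTheorem2 {k : Type*} [Field k] (ν : k) (hν : ν ≠ 0) :
    -- the Woronowicz algebra is a 3-dimensional skew polynomial algebra in its generators
    IsSkewPolynomialAlgebra3 k
      (Woronowicz.gen ν 0) (Woronowicz.gen ν 1) (Woronowicz.gen ν 2) ∧
    -- it is presented by a skew reduction system
    IsSkewReductionSystem (woronowiczRule ν) ∧
    woronowiczIdeal ν = (skewSystem (woronowiczRule ν)).ideal ∧
    -- the only ambiguity is the overlap in `x₃x₂x₁`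
    (∀ (σ τ : FreeMonoid (Fin 3) × FreeAss k (Fin 3)) (A B C : FreeMonoid (Fin 3)),
      (skewSystem (woronowiczRule ν)).IsOverlapAmbiguity σ τ A B C ↔
        σ = (FreeMonoid.of 2 * FreeMonoid.of 1, woronowiczRule ν 2 1) ∧
        τ = (FreeMonoid.of 1 * FreeMonoid.of 0, woronowiczRule ν 1 0) ∧
        A = FreeMonoid.of 2 ∧ B = FreeMonoid.of 1 ∧ C = FreeMonoid.of 0) ∧
    (∀ (σ τ : FreeMonoid (Fin 3) × FreeAss k (Fin 3)) (A B C : FreeMonoid (Fin 3)),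
      ¬ (skewSystem (woronowiczRule ν)).IsInclusionAmbiguity σ τ A B C) ∧
    -- it is solvable
    (skewSystem (woronowiczRule ν)).OverlapSolvable
      (FreeMonoid.of 2 * FreeMonoid.of 1, woronowiczRule ν 2 1)
      (FreeMonoid.of 1 * FreeMonoid.of 0, woronowiczRule ν 1 0)
      (FreeMonoid.of 2) (FreeMonoid.of 0) ∧
    -- the common standard form of `x₃ f₂₁` and `f₃₂ x₁`
    IsStred (woronowiczRule ν) (var k 2 * woronowiczRule ν 1 0)
      (ν⁻¹ ^ 2 • (var k 0 * var k 1 * var k 2) - ν⁻¹ • var k 2 ^ 2) ∧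
    IsStred (woronowiczRule ν) (woronowiczRule ν 2 1 * var k 0)
      (ν⁻¹ ^ 2 • (var k 0 * var k 1 * var k 2) - ν⁻¹ • var k 2 ^ 2) := by
  exact ⟨isSkewPolynomialAlgebra3_woronowicz hν, isSkewReductionSystem_woronowiczRule hν,
    woronowiczIdeal_eq_ideal_skewSystem hν, isOverlapAmbiguity_skewSystem_fin_three _,
    not_isInclusionAmbiguity_skewSystem _, overlapSolvable_woronowiczRule hν,
    isStred_var_two_mul_woronowiczRule hν, isStred_woronowiczRule_mul_var_zero hν⟩
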